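/- Let $A\in\mathbb{R}^{m\times n}$, $b\in\mathbb{R}^m$, $c\in\mathbb{R}^n$, and consider the primal linear program $\min\{c^Tx : Ax=b,\ x\ge 0\}$ over $x\in\mathbb{R}^n$ and its dual $\max\{b^T\lambda : A^T\lambda+s=c,\ s\ge 0\}$ over $(\lambda,s)\in\mathbb{R}^m\times\mathbb{R}^n$. An optimal solution of the primal-dual pair is a triple $(x,\lambda,s)\in\mathbb{R}^{2n+m}$ such that $x$ is optimal for the primal program and $(\lambda,s)$ is optimal for the dual program. Suppose that the set of optimal solutions of the primal-dual pair is nonempty and bounded. Let $$f_3(x,\lambda,s)=\tfrac12(c^Tx-b^T\lambda)^2+\tfrac12\|Ax-b\|_2^2+\tfrac12\|A^T\lambda+s-c\|_2^2+\tfrac16\sum_{j=1}^n\left(\max\{-x_j,0\}^3+\max\{-s_j,0\}^3\right),$$ let $z^0=(x^0,\lambda^0,s^0)\in\mathbb{R}^{2n+m}$ be arbitrary, and let $z^k=(x^k,\lambda^k,s^k)$ be the iterates of Newton's method with Levenberg–Marquardt regularization and unit steps, $$z^{k+1}=z^k-\left(\nabla^2 f_3(z^k)+\mu^kI\right)^{-1}\nabla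 f_3(z^k),\qquad \mu^k=\sqrt{\|\nabla f_3(z^k)\|_2/2},$$ where $z^{k+1}=z^k$ if $\nabla f_3(z^k)=0$ (the method has stopped). Then $\nabla^2 f_3(z^k)+\mu^kI$ is invertible whenever $\nabla f_3(z^k)\neq 0$, and there is a constant $C>0$, depending only on $A,b,c$ and $z^0$, such that for every $\epsilon\in(0,1]$ and every integer $k\ge C\epsilon^{-3/2}$, $$|c^Tx^k-b^T\lambda^k|\le\epsilon,\qquad \|Ax^k-b\|_2\le\epsilon,\qquad \|A^T\lambda^k+s^k-c\|_2\le\epsilon,$$ $$x^k_j\ge-\epsilon\quad\text{and}\quad s^k_j\ge-\epsilon\qquad\text{for } j=1,\dots,n.$$ -/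

import Mathlib

namespace LPMerit

open scoped Matrix

noncomputable section

/-! The standard-form linear program, minimise `cᵀx` subject to `A x = b`, `x ≥ 0`, and its dual,
maximise `bᵀy` subject to `Aᵀ y + s = c`, `s ≥ 0`. The dual multiplier is called `y` here. -/

/-- `x` satisfies the constraints of the primal program. -/
def PrimalFeasible {m n : ℕ} (A : Matrix (Fin m) (Fin n) ℝ) (b : Fin m → ℝ)
    (x : Fin n → ℝ) : Prop :=
  A *ᵥ x = b ∧ ∀ j, 0 ≤ x j

/-- `(y, s)` satisfies the constraints of the dual program. -/
def DualFeasible {m n : ℕ} (A : Matrix (Fin m) (Fin n) ℝ) (c : Fin n → ℝ)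
    (y : Fin m → ℝ) (s : Fin n → ℝ) : Prop :=
  Aᵀ *ᵥ y + s = c ∧ ∀ j, 0 ≤ s j

/-- `x` is an optimal solution of the primal program. -/
def PrimalOptimal {m n : ℕ} (A : Matrix (Fin m) (Fin n) ℝ) (b : Fin m → ℝ) (c : Fin n → ℝ)
    (x : Fin n → ℝ) : Prop :=
  PrimalFeasible A b x ∧ ∀ x', PrimalFeasible A b x' → c ⬝ᵥ x ≤ c ⬝ᵥ x'

/-- `(y, s)` is an optimal solution of the dual program. -/
def DualOptimal {m n : ℕ} (A : Matrix (Fin m) (Fin n) ℝ) (b : Fin m → ℝ) (c : Fin n → ℝ)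
    (y : Fin m → ℝ) (s : Fin n → ℝ) : Prop :=
  DualFeasible A c y s ∧ ∀ y' s', DualFeasible A c y' s' → b ⬝ᵥ y' ≤ b ⬝ᵥ y

/-- The space of triples `(x, y, s)`, that is `ℝ^(2n+m)` with the Euclidean norm. -/
abbrev PDSpace (m n : ℕ) : Type := EuclideanSpace ℝ (Fin n ⊕ (Fin m ⊕ Fin n))

/-- The component `x` of `(x, y, s)`. -/
def xPart {m n : ℕ} (z : PDSpace m n) : Fin n → ℝ := fun j => z (Sum.inl j)

/-- The component `y` of `(x, y, s)`. -/
def yPart {m n : ℕ} (z : PDSpace m n) : Fin m → ℝ := fun i => z (Sum.inr (Sum.inl i))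

/-- The component `s` of `(x, y, s)`. -/
def sPart {m n : ℕ} (z : PDSpace m n) : Fin n → ℝ := fun j => z (Sum.inr (Sum.inr j))

/-- The set of optimal solutions of the primal-dual pair. -/
def optimalSet {m n : ℕ} (A : Matrix (Fin m) (Fin n) ℝ) (b : Fin m → ℝ) (c : Fin n → ℝ) :
    Set (PDSpace m n) :=
  {z | PrimalOptimal A b c (xPart z) ∧ DualOptimal A b c (yPart z) (sPart z)}

/-- The signed duality gap `cᵀx - bᵀy`. -/
def dualityGap {m n : ℕ} (b : Fin m → ℝ) (c : Fin n → ℝ) (z : PDSpace m n) : ℝ :=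
  c ⬝ᵥ xPart z - b ⬝ᵥ yPart z

/-- The primal residual `A x - b`, a vector of the Euclidean space `ℝ^m`. -/
def primalResidual {m n : ℕ} (A : Matrix (Fin m) (Fin n) ℝ) (b : Fin m → ℝ) (z : PDSpace m n) :
    EuclideanSpace ℝ (Fin m) :=
  WithLp.toLp 2 (A *ᵥ xPart z - b)

/-- The dual residual `Aᵀ y + s - c`, a vector of the Euclidean space `ℝ^n`. -/
def dualResidual {m n : ℕ} (A : Matrix (Fin m) (Fin n) ℝ) (c : Fin n → ℝ) (z : PDSpace m n) :
    EuclideanSpace ℝ (Fin n) :=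
  WithLp.toLp 2 (Aᵀ *ᵥ yPart z + sPart z - c)

/-- The merit function `f_q` for `q = 3`; the weight of the penalty is `1 / (q (q - 1)) = 1 / 6`. -/
def merit {m n : ℕ} (A : Matrix (Fin m) (Fin n) ℝ) (b : Fin m → ℝ) (c : Fin n → ℝ)
    (z : PDSpace m n) : ℝ :=
  1 / 2 * dualityGap b c z ^ 2 + 1 / 2 * ‖primalResidual A b z‖ ^ 2
    + 1 / 2 * ‖dualResidual A c z‖ ^ 2
    + 1 / 6 * ∑ j, (max (-(xPart z j)) 0 ^ 3 + max (-(sPart z j)) 0 ^ 3)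

section Newton

variable {E : Type*} [NormedAddCommGroup E] [InnerProductSpace ℝ E] [CompleteSpace E]

/-- The Hessian of `f` at `z`, as an operator: the derivative of the gradient. -/
def hessian (f : E → ℝ) (z : E) : E →L[ℝ] E := fderiv ℝ (gradient f) z

/-- The regularisation parameter `√(‖∇f(z)‖ / 2)`. -/
def lmParam (f : E → ℝ) (z : E) : ℝ := √(‖gradient f z‖ / 2)

/-- The regularised Hessian `∇²f(z) + μ I` with `μ = √(‖∇f(z)‖ / 2)`. -/
def lmOperator (f : E → ℝ) (z : E) : E →L[ℝ] E :=
  hessian f z + lmParam f z • ContinuousLinearMap.id ℝ E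

/-- One Newton step with Levenberg-Marquardt regularisation and unit step length.
If the gradient vanishes at `z` then the step is `z` itself: the method has stopped. -/
def lmStep (f : E → ℝ) (z : E) : E := z - (lmOperator f z).inverse (gradient f z)

/-- The iterates of the method started at `z₀`. -/
def lmIterate (f : E → ℝ) (z₀ : E) : ℕ → E
  | 0 => z₀
  | k + 1 => lmStep f (lmIterate f z₀ k)

end Newton

end

end LPMerit

/-! The merit function is half the squared norm of an affine residual plus a cubic sign penalty. It
is convex and its Hessian is `1`-Lipschitz, since `max (-t) 0` is. A bounded optimal set leaves no
recession direction (`eq_zero_of_recession`), so sublevel sets are bounded and a minimiser exists.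
Its stationarity conditions form a homogenised primal-dual system, from which weak duality alone
yields the minimal value `0` (`exists_merit_eq_zero`); strong duality is not assumed.

For such an `f`, let `μ` be the regularisation parameter, so that `2 * μ ^ 2` is the gradient norm.
A step at most doubles the gradient norm, and either divides it by `4` or lowers `f` by `μ ^ 3 /
24`. Convexity gives `f ≤ B ^ 2 * μ ^ 2`. If steps of the second kind are at least half of all, the
decrease of order `f ^ (3 / 2)` gives `f = O(1 / k ^ 2)`; otherwise the gradient decays
geometrically (`exists_lmIterate_rate`). Accuracy `ε` follows from `f ≤ ε ^ 3 / 6`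
(`bounds_of_merit_le`), whence the exponent `3 / 2`. -/

namespace LPMerit

open scoped Matrix RealInnerProductSpace

/-! ### The scalar penalty `φ t = max (-t) 0 ^ 3 / 6`. -/

section OneDim

/-- First-order Taylor remainder of `φ'`; the factor `1 / 2` reflects that `φ'' t = max (-t) 0` is
`1`-Lipschitz. -/
lemma abs_negPart_sq_remainder_le (t h : ℝ) :
    |-(max (-(t + h)) 0 ^ 2 / 2) + max (-t) 0 ^ 2 / 2 - max (-t) 0 * h| ≤ h ^ 2 / 2 := by
  rcases le_total 0 t with ht | ht <;> rcases le_total 0 (t + h) with hh | hh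
  · rw [max_eq_right (by linarith), max_eq_right (by linarith)]
    norm_num; positivity
  · rw [max_eq_left (by linarith), max_eq_right (by linarith), abs_le]
    constructor <;> nlinarith
  · rw [max_eq_right (by linarith), max_eq_left (by linarith), abs_le]
    constructor <;> nlinarith [sq_nonneg (t + h)]
  · rw [max_eq_left (by linarith), max_eq_left (by linarith), abs_le]
    constructor <;> nlinarith [sq_nonneg h]

lemma abs_negPart_cube_remainder_le (t h : ℝ) :
    |max (-(t + h)) 0 ^ 3 / 6 - max (-t) 0 ^ 3 / 6 + max (-t) 0 ^ 2 / 2 * h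
      - max (-t) 0 * h ^ 2 / 2| ≤ |h| ^ 3 / 6 := by
  rcases le_total 0 t with ht | ht <;> rcases le_total 0 (t + h) with hh | hh
  · rw [max_eq_right (by linarith), max_eq_right (by linarith)]
    norm_num; positivity
  · rw [max_eq_left (by linarith), max_eq_right (by linarith), abs_of_nonpos (by linarith : h ≤ 0)]
    have h1 : 0 ≤ (-(t + h)) ^ 3 := pow_nonneg (by linarith) 3
    have h2 : (-(t + h)) ^ 3 ≤ (-h) ^ 3 := pow_le_pow_left₀ (by linarith) (by linarith) 3
    rw [abs_le]; constructor <;> linarith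
  · rw [max_eq_right (by linarith), max_eq_left (by linarith), abs_of_nonneg (by linarith : 0 ≤ h)]
    have h1 : 0 ≤ (t + h) ^ 3 := pow_nonneg hh 3
    have h2 : (t + h) ^ 3 ≤ h ^ 3 := pow_le_pow_left₀ hh (by linarith) 3
    rw [abs_le]; constructor <;> linarith
  · rw [max_eq_left (by linarith), max_eq_left (by linarith)]
    have : (-(t + h)) ^ 3 / 6 - (-t) ^ 3 / 6 + (-t) ^ 2 / 2 * h - -t * h ^ 2 / 2 = -(h ^ 3 / 6) := by
      ring
    rw [this, abs_neg, abs_div, abs_pow]; norm_num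

lemma negPart_cube_tangent_le (t u : ℝ) :
    max (-t) 0 ^ 3 / 6 - max (-t) 0 ^ 2 / 2 * (u - t) ≤ max (-u) 0 ^ 3 / 6 := by
  have hu : 0 ≤ max (-u) 0 := le_max_right _ _
  have hu' : -u ≤ max (-u) 0 := le_max_left _ _
  generalize max (-u) 0 = q at *
  rcases le_total 0 t with ht | ht
  · rw [max_eq_right (by linarith)]
    have := pow_nonneg hu 3
    linarith
  · rw [max_eq_left (by linarith)]
    have h1 : 0 ≤ t ^ 2 * (q + u) := mul_nonneg (sq_nonneg _) (by linarith)
    -- After clearing denominators, the claim is the sum of this inequality and three times `h1`.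
    have h2 : 0 ≤ (q + t) ^ 2 * (q - 2 * t) := mul_nonneg (sq_nonneg _) (by linarith)
    nlinarith

end OneDim

/-! ### Least squares with cubic penalty: coercivity, derivatives, convexity. -/

section PenaltyModel

variable {ι F : Type*} [Fintype ι] [NormedAddCommGroup F] [InnerProductSpace ℝ F]

/-- The model `½‖T z - v‖² + ⅙ ∑ wᵢ max(-zᵢ, 0)³`. -/
noncomputable def penaltyModel (T : EuclideanSpace ℝ ι →L[ℝ] F) (v : F) (w : ι → ℝ)
    (z : EuclideanSpace ℝ ι) : ℝ :=
  1 / 2 * ‖T z - v‖ ^ 2 + ∑ i, w i * (max (-z i) 0 ^ 3 / 6)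

/-- Multiplication by a vector, coordinate by coordinate. -/
noncomputable def diagonalOperator (a : ι → ℝ) : EuclideanSpace ℝ ι →L[ℝ] EuclideanSpace ℝ ι :=
  LinearMap.toContinuousLinearMap
    { toFun := fun z => WithLp.toLp 2 fun i => a i * z i
      map_add' := fun x y => by ext i; simp [mul_add]
      map_smul' := fun r x => by ext i; simp; ring }

@[simp] lemma diagonalOperator_apply (a : ι → ℝ) (z : EuclideanSpace ℝ ι) (i : ι) :
    diagonalOperator a z i = a i * z i := rfl

variable (T : EuclideanSpace ℝ ι →L[ℝ] F) (v : F) {w : ι → ℝ}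

lemma penaltyModel_nonneg (hw : ∀ i, 0 ≤ w i) (z : EuclideanSpace ℝ ι) :
    0 ≤ penaltyModel T v w z := by
  have : ∀ i, 0 ≤ w i * (max (-z i) 0 ^ 3 / 6) := fun i => mul_nonneg (hw i) (by positivity)
  have := Finset.sum_nonneg fun i (_ : i ∈ Finset.univ) => this i
  rw [penaltyModel]; positivity

lemma continuous_penaltyModel : Continuous (penaltyModel T v w) := by
  unfold penaltyModel; fun_prop

/-- If no nonzero direction is recessive, then the sublevel sets of the model are bounded. -/
lemma exists_norm_le_of_penaltyModel_le (hw : ∀ i, 0 ≤ w i) (hw1 : ∀ i, w i ≤ 1)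
    (hrec : ∀ d : EuclideanSpace ℝ ι, T d = 0 → (∀ i, w i * max (-d i) 0 = 0) → d = 0) (a : ℝ) :
    ∃ R, ∀ z, penaltyModel T v w z ≤ a → ‖z‖ ≤ R := by
  -- `h` is positively homogeneous, and positive on the unit sphere because a zero would be a
  -- recession direction. Compactness then gives `δ * ‖z‖ ≤ h z`, while `h` is bounded above on
  -- sublevel sets.
  let h : EuclideanSpace ℝ ι → ℝ := fun d => ‖T d‖ + ∑ i, w i * max (-d i) 0
  have hterm : ∀ (d : EuclideanSpace ℝ ι) i, 0 ≤ w i * max (-d i) 0 := fun d i =>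
    mul_nonneg (hw i) (le_max_right _ _)
  have hsum : ∀ d : EuclideanSpace ℝ ι, 0 ≤ ∑ i, w i * max (-d i) 0 := fun d =>
    Finset.sum_nonneg fun i _ => hterm d i
  have hpos : ∀ d ∈ Metric.sphere (0 : EuclideanSpace ℝ ι) 1, 0 < h d := by
    intro d hd
    have h0 : 0 ≤ h d := add_nonneg (norm_nonneg _) (hsum d)
    refine lt_of_le_of_ne h0 fun h1 => ?_
    have h2 := (add_eq_zero_iff_of_nonneg (norm_nonneg _) (hsum d)).1 h1.symm
    have h3 := hrec d (norm_eq_zero.1 h2.1) fun i =>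
      (Finset.sum_eq_zero_iff_of_nonneg fun i _ => hterm d i).1 h2.2 i (Finset.mem_univ i)
    simp [h3] at hd
  have hcont : Continuous h := by fun_prop
  obtain ⟨δ, hδ, hδh⟩ := (isCompact_sphere (0 : EuclideanSpace ℝ ι) 1).exists_forall_le'
    hcont.continuousOn hpos
  have hlow : ∀ z, δ * ‖z‖ ≤ h z := by
    intro z
    rcases eq_or_ne z 0 with rfl | hz
    · rw [norm_zero, mul_zero]; exact add_nonneg (norm_nonneg (T 0)) (hsum 0)
    have hz' := norm_pos_iff.2 hz
    have h1 := hδh (‖z‖⁻¹ • z) (by simp [norm_smul, hz])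
    have h2 : h (‖z‖⁻¹ • z) = ‖z‖⁻¹ * h z := by
      have hi : 0 ≤ ‖z‖⁻¹ := by positivity
      simp only [h, map_smul, norm_smul, norm_inv, norm_norm, mul_add, Finset.mul_sum,
        PiLp.smul_apply, smul_eq_mul]
      congr 1
      refine Finset.sum_congr rfl fun i _ => ?_
      rw [mul_left_comm, mul_max_of_nonneg _ _ hi, mul_zero, mul_neg]
    rw [h2, inv_mul_eq_div, le_div_iff₀ hz'] at h1
    exact h1
  refine ⟨(1 + 2 * a + ‖v‖ + Fintype.card ι * (1 + 6 * a)) / δ, fun z hz => ?_⟩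
  rw [le_div_iff₀ hδ, mul_comm]
  refine (hlow z).trans ?_
  have hcube : ∀ i, 0 ≤ w i * (max (-z i) 0 ^ 3 / 6) := fun i => mul_nonneg (hw i) (by positivity)
  have hcubes := Finset.sum_nonneg fun i (_ : i ∈ Finset.univ) => hcube i
  rw [penaltyModel] at hz
  have h1 : ‖T z‖ ≤ 1 + 2 * a + ‖v‖ := by
    have h2 := norm_add_le (T z - v) v
    rw [sub_add_cancel] at h2
    nlinarith [sq_nonneg (‖T z - v‖ - 1)]
  have h2 : ∑ i, w i * max (-z i) 0 ≤ ∑ _i : ι, (1 + 6 * a) := by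
    refine Finset.sum_le_sum fun i _ => ?_
    have h3 := Finset.single_le_sum (fun i _ => hcube i) (Finset.mem_univ i)
    have h4 : max (-z i) 0 ≤ 1 + max (-z i) 0 ^ 3 := by
      have : 0 ≤ max (-z i) 0 := le_max_right _ _
      nlinarith [mul_nonneg this (sq_nonneg (max (-z i) 0 - 1)), sq_nonneg (max (-z i) 0 - 1)]
    have h5 := mul_le_mul_of_nonneg_left h4 (hw i)
    nlinarith [hw1 i, sq_nonneg ‖T z - v‖]
  rw [Finset.sum_const, Finset.card_univ, nsmul_eq_mul] at h2
  linarith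

variable [CompleteSpace F]

/-- The gradient of `penaltyModel`. -/
noncomputable def penaltyGradient (T : EuclideanSpace ℝ ι →L[ℝ] F) (v : F) (w : ι → ℝ)
    (z : EuclideanSpace ℝ ι) : EuclideanSpace ℝ ι :=
  T.adjoint (T z - v) - WithLp.toLp 2 fun i => w i * (max (-z i) 0 ^ 2 / 2)

/-- The Hessian of `penaltyModel`. -/
noncomputable def penaltyHessian (T : EuclideanSpace ℝ ι →L[ℝ] F) (w : ι → ℝ)
    (z : EuclideanSpace ℝ ι) : EuclideanSpace ℝ ι →L[ℝ] EuclideanSpace ℝ ι :=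
  T.adjoint ∘L T + diagonalOperator fun i => w i * max (-z i) 0

lemma inner_penaltyGradient (z d : EuclideanSpace ℝ ι) :
    ⟪penaltyGradient T v w z, d⟫ =
      ⟪T z - v, T d⟫ - ∑ i, w i * (max (-z i) 0 ^ 2 / 2) * d i := by
  rw [penaltyGradient, inner_sub_left, ContinuousLinearMap.adjoint_inner_left]
  congr 1
  simp [PiLp.inner_apply, mul_comm]

lemma inner_penaltyHessian (z d : EuclideanSpace ℝ ι) :
    ⟪penaltyHessian T w z d, d⟫ = ‖T d‖ ^ 2 + ∑ i, w i * max (-z i) 0 * d i ^ 2 := by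
  rw [penaltyHessian, _root_.add_apply, inner_add_left,
    ContinuousLinearMap.comp_apply, ContinuousLinearMap.adjoint_inner_left,
    real_inner_self_eq_norm_sq]
  congr 1
  simp only [PiLp.inner_apply, diagonalOperator_apply, RCLike.inner_apply, conj_trivial]
  exact Finset.sum_congr rfl fun i _ => by ring

lemma inner_penaltyHessian_nonneg (hw : ∀ i, 0 ≤ w i) (z d : EuclideanSpace ℝ ι) :
    0 ≤ ⟪penaltyHessian T w z d, d⟫ := by
  rw [inner_penaltyHessian]
  have : ∀ i, 0 ≤ w i * max (-z i) 0 * d i ^ 2 := fun i =>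
    mul_nonneg (mul_nonneg (hw i) (le_max_right _ _)) (sq_nonneg _)
  have := Finset.sum_nonneg fun i (_ : i ∈ Finset.univ) => this i
  positivity

lemma abs_apply_le_norm (d : EuclideanSpace ℝ ι) (i : ι) : |d i| ≤ ‖d‖ := by
  simpa using PiLp.norm_apply_le d i

/-- The affine part leaves no remainder, and the penalty leaves at most `d i ^ 2 / 2` in each
coordinate. Since `∑ d i ^ 4 ≤ ‖d‖ ^ 4`, the constant is independent of the dimension. -/
lemma norm_penaltyGradient_remainder_le (hw : ∀ i, 0 ≤ w i) (hw1 : ∀ i, w i ≤ 1)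
    (z d : EuclideanSpace ℝ ι) :
    ‖penaltyGradient T v w (z + d) - penaltyGradient T v w z - penaltyHessian T w z d‖
      ≤ ‖d‖ ^ 2 / 2 := by
  set e := penaltyGradient T v w (z + d) - penaltyGradient T v w z - penaltyHessian T w z d with he
  have hi : ∀ i, |e i| ≤ d i ^ 2 / 2 := by
    intro i
    have : e i = w i * (-(max (-(z i + d i)) 0 ^ 2 / 2) + max (-z i) 0 ^ 2 / 2
        - max (-z i) 0 * d i) := by
      simp only [he, penaltyGradient, penaltyHessian, map_add, map_sub, PiLp.sub_apply,
        PiLp.add_apply, _root_.add_apply, ContinuousLinearMap.comp_apply,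
        diagonalOperator_apply]
      ring
    rw [this, abs_mul, abs_of_nonneg (hw i)]
    have h1 := abs_negPart_sq_remainder_le (z i) (d i)
    have h2 := abs_nonneg (-(max (-(z i + d i)) 0 ^ 2 / 2) + max (-z i) 0 ^ 2 / 2
        - max (-z i) 0 * d i)
    nlinarith [hw i, hw1 i]
  refine abs_le_of_sq_le_sq' ?_ (by positivity) |>.2
  rw [EuclideanSpace.real_norm_sq_eq]
  calc ∑ i, e i ^ 2 ≤ ∑ i, d i ^ 2 * (‖d‖ ^ 2 / 4) := by
        refine Finset.sum_le_sum fun i _ => ?_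
        have h1 := sq_le_sq' (abs_le.1 (hi i)).1 (abs_le.1 (hi i)).2
        have h2 : d i ^ 2 ≤ ‖d‖ ^ 2 := sq_le_sq.2 (by simpa using abs_apply_le_norm d i)
        nlinarith [sq_nonneg (d i)]
    _ = (‖d‖ ^ 2 / 2) ^ 2 := by
        rw [← Finset.sum_mul, ← EuclideanSpace.real_norm_sq_eq]; ring

lemma abs_penaltyModel_remainder_le (hw : ∀ i, 0 ≤ w i) (hw1 : ∀ i, w i ≤ 1)
    (z d : EuclideanSpace ℝ ι) :
    |penaltyModel T v w (z + d) - penaltyModel T v w z - ⟪penaltyGradient T v w z, d⟫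
      - 1 / 2 * ⟪penaltyHessian T w z d, d⟫| ≤ ‖d‖ ^ 3 / 6 := by
  have hq : ‖T (z + d) - v‖ ^ 2 = ‖T z - v‖ ^ 2 + 2 * ⟪T z - v, T d⟫ + ‖T d‖ ^ 2 := by
    rw [map_add, add_sub_right_comm, norm_add_sq_real]
  have : penaltyModel T v w (z + d) - penaltyModel T v w z - ⟪penaltyGradient T v w z, d⟫
      - 1 / 2 * ⟪penaltyHessian T w z d, d⟫ =
      ∑ i, w i * (max (-(z i + d i)) 0 ^ 3 / 6 - max (-z i) 0 ^ 3 / 6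
        + max (-z i) 0 ^ 2 / 2 * d i - max (-z i) 0 * d i ^ 2 / 2) := by
    rw [inner_penaltyGradient, inner_penaltyHessian, penaltyModel, penaltyModel, hq]
    have : ∀ i, w i * (max (-(z i + d i)) 0 ^ 3 / 6 - max (-z i) 0 ^ 3 / 6
        + max (-z i) 0 ^ 2 / 2 * d i - max (-z i) 0 * d i ^ 2 / 2) =
        w i * (max (-(z + d) i) 0 ^ 3 / 6) - w i * (max (-z i) 0 ^ 3 / 6)
        + w i * (max (-z i) 0 ^ 2 / 2) * d i - 1 / 2 * (w i * max (-z i) 0 * d i ^ 2) := by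
      intro i; rw [PiLp.add_apply]; ring
    simp only [this, Finset.sum_add_distrib, Finset.sum_sub_distrib, ← Finset.mul_sum]
    ring
  rw [this]
  calc _ ≤ ∑ i, |w i * (max (-(z i + d i)) 0 ^ 3 / 6 - max (-z i) 0 ^ 3 / 6
        + max (-z i) 0 ^ 2 / 2 * d i - max (-z i) 0 * d i ^ 2 / 2)| :=
        Finset.abs_sum_le_sum_abs _ _
    _ ≤ ∑ i, d i ^ 2 * (‖d‖ / 6) := by
        refine Finset.sum_le_sum fun i _ => ?_
        rw [abs_mul, abs_of_nonneg (hw i)]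
        have h1 := abs_negPart_cube_remainder_le (z i) (d i)
        have h2 : |d i| ^ 3 ≤ d i ^ 2 * ‖d‖ := by
          rw [pow_succ, sq_abs]
          exact mul_le_mul_of_nonneg_left (abs_apply_le_norm d i) (sq_nonneg _)
        have h3 := mul_le_of_le_one_left (abs_nonneg (max (-(z i + d i)) 0 ^ 3 / 6
          - max (-z i) 0 ^ 3 / 6 + max (-z i) 0 ^ 2 / 2 * d i - max (-z i) 0 * d i ^ 2 / 2)) (hw1 i)
        linarith
    _ = ‖d‖ ^ 3 / 6 := by
        rw [← Finset.sum_mul, ← EuclideanSpace.real_norm_sq_eq]; ring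

lemma penaltyModel_tangent_le (hw : ∀ i, 0 ≤ w i) (z u : EuclideanSpace ℝ ι) :
    penaltyModel T v w z + ⟪penaltyGradient T v w z, u - z⟫ ≤ penaltyModel T v w u := by
  have hq : ‖T u - v‖ ^ 2 = ‖T z - v‖ ^ 2 + 2 * ⟪T z - v, T (u - z)⟫ + ‖T (u - z)‖ ^ 2 := by
    rw [← norm_add_sq_real, map_sub]; congr 2; abel
  have hs : ∑ i, w i * (max (-z i) 0 ^ 3 / 6) - ∑ i, w i * (max (-z i) 0 ^ 2 / 2) * (u - z) i ≤
      ∑ i, w i * (max (-u i) 0 ^ 3 / 6) := by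
    rw [← Finset.sum_sub_distrib]
    refine Finset.sum_le_sum fun i _ => ?_
    have := mul_le_mul_of_nonneg_left (negPart_cube_tangent_le (z i) (u i)) (hw i)
    rw [PiLp.sub_apply]
    linarith
  rw [inner_penaltyGradient, penaltyModel, penaltyModel, hq]
  nlinarith [sq_nonneg ‖T (u - z)‖]

/-- Turns the Taylor estimates above into derivatives, so that the penalty need not be
differentiated by the calculus rules. -/
lemma hasFDerivAt_of_norm_remainder_le {E G : Type*} [NormedAddCommGroup E] [NormedSpace ℝ E]
    [NormedAddCommGroup G] [NormedSpace ℝ G] {f : E → G} {L : E →L[ℝ] G} {z : E} {K₁ K₂ : ℝ}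
    (h : ∀ d, ‖f (z + d) - f z - L d‖ ≤ K₁ * ‖d‖ ^ 2 + K₂ * ‖d‖ ^ 3) : HasFDerivAt f L z := by
  rw [hasFDerivAt_iff_isLittleO_nhds_zero]
  have h1 : (fun d : E => K₁ * ‖d‖ ^ 2 + K₂ * ‖d‖ ^ 3) =o[nhds 0] fun d => d :=
    ((Asymptotics.isLittleO_norm_pow_id (by norm_num)).const_mul_left _).add
      ((Asymptotics.isLittleO_norm_pow_id (by norm_num)).const_mul_left _)
  refine Asymptotics.IsBigO.trans_isLittleO (Asymptotics.IsBigO.of_bound 1 ?_) h1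
  filter_upwards with d
  rw [one_mul]
  exact (h d).trans (le_abs_self _)

lemma hasGradientAt_penaltyModel (hw : ∀ i, 0 ≤ w i) (hw1 : ∀ i, w i ≤ 1)
    (z : EuclideanSpace ℝ ι) :
    HasGradientAt (penaltyModel T v w) (penaltyGradient T v w z) z := by
  rw [hasGradientAt_iff_hasFDerivAt]
  refine hasFDerivAt_of_norm_remainder_le (K₁ := ‖penaltyHessian T w z‖ / 2) (K₂ := 1 / 6) ?_
  intro d
  rw [InnerProductSpace.toDual_apply_apply, Real.norm_eq_abs]
  have h1 := abs_le.1 (abs_penaltyModel_remainder_le T v hw hw1 z d)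
  have h2 : |⟪penaltyHessian T w z d, d⟫| ≤ ‖penaltyHessian T w z‖ * ‖d‖ ^ 2 := by
    refine (abs_real_inner_le_norm _ _).trans ?_
    rw [pow_two, ← mul_assoc]
    exact mul_le_mul_of_nonneg_right (ContinuousLinearMap.le_opNorm _ _) (norm_nonneg _)
  have h2 := abs_le.1 h2
  rw [abs_le]
  constructor <;> linarith

lemma gradient_penaltyModel (hw : ∀ i, 0 ≤ w i) (hw1 : ∀ i, w i ≤ 1) :
    gradient (penaltyModel T v w) = penaltyGradient T v w :=
  funext fun z => (hasGradientAt_penaltyModel T v hw hw1 z).gradient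

lemma hessian_penaltyModel (hw : ∀ i, 0 ≤ w i) (hw1 : ∀ i, w i ≤ 1) (z : EuclideanSpace ℝ ι) :
    hessian (penaltyModel T v w) z = penaltyHessian T w z := by
  rw [hessian, gradient_penaltyModel T v hw hw1]
  refine (hasFDerivAt_of_norm_remainder_le (K₁ := 1 / 2) (K₂ := 0) fun d => ?_).fderiv
  have := norm_penaltyGradient_remainder_le T v hw hw1 z d
  linarith

/-- A stationary point of the model at which the residual has a nonnegative inner product with `v`
is a zero of the model. -/
lemma penaltyModel_eq_zero (hw : ∀ i, 0 ≤ w i) {z : EuclideanSpace ℝ ι}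
    (hz : penaltyGradient T v w z = 0) (hv : 0 ≤ ⟪T z - v, v⟫) : penaltyModel T v w z = 0 := by
  -- Pairing stationarity with `z` itself gives `0 = ‖T z - v‖ ^ 2 + ⟪T z - v, v⟫ + 3 * penalty`, a
  -- sum of nonnegative terms.
  have h1 := inner_penaltyGradient T v (w := w) z z
  have h2 : ⟪T z - v, T z⟫ = ‖T z - v‖ ^ 2 + ⟪T z - v, v⟫ := by
    rw [← real_inner_self_eq_norm_sq, ← inner_add_right, sub_add_cancel]
  have h3 : ∑ i, w i * (max (-z i) 0 ^ 2 / 2) * z i = -3 * ∑ i, w i * (max (-z i) 0 ^ 3 / 6) := by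
    rw [Finset.mul_sum]
    refine Finset.sum_congr rfl fun i _ => ?_
    rcases le_total 0 (z i) with h | h
    · rw [max_eq_right (by linarith)]; ring
    · rw [max_eq_left (by linarith)]; ring
  rw [hz, inner_zero_left, h2, h3] at h1
  have h4 := penaltyModel_nonneg T v hw z
  have h5 := Finset.sum_nonneg fun i (_ : i ∈ Finset.univ) =>
    mul_nonneg (hw i) (by positivity : 0 ≤ max (-z i) 0 ^ 3 / 6)
  rw [penaltyModel] at h4 ⊢
  nlinarith [sq_nonneg ‖T z - v‖]

end PenaltyModel

/-! ### A rate for real sequences satisfying the two-way alternative. -/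

section Rate

lemma sq_le_four_mul_two_pow (N : ℕ) : (N : ℝ) ^ 2 ≤ 4 * 2 ^ N := by
  induction N with
  | zero => norm_num
  | succ N ih =>
    rcases Nat.lt_or_ge N 3 with h | h
    · interval_cases N <;> norm_num
    · have : (3 : ℝ) ≤ N := by exact_mod_cast h
      push_cast
      rw [pow_succ 2 N]
      nlinarith

/-- If every step either decreases `f` by a multiple of `h³`, while `h` at most grows by a bounded
factor, or shrinks `h²` by the factor `4`, and `f ≤ B² h²`, then `f` is of order `1 / k²`. -/
lemma exists_mul_sq_le_of_alternative {f h : ℕ → ℝ} {B : ℝ} (hB : 0 < B) (hf : ∀ k, 0 ≤ f k)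
    (hh : ∀ k, 0 ≤ h k) (hfh : ∀ k, f k ≤ B ^ 2 * h k ^ 2) (hmono : ∀ k, f (k + 1) ≤ f k)
    (hgrow : ∀ k, h (k + 1) ^ 2 ≤ 2 * h k ^ 2)
    (halt : ∀ k, 4 * h (k + 1) ^ 2 ≤ h k ^ 2 ∨ f (k + 1) + h k ^ 3 / 24 ≤ f k) :
    ∃ C : ℝ, 0 < C ∧ ∀ k : ℕ, f k * (k : ℝ) ^ 2 ≤ C := by
  -- Chosen so that `√f ≤ B * h` turns a decrease of `h ^ 3 / 24` into one of `2 * c * √f ^ 3`.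
  set c : ℝ := 1 / (48 * B ^ 3) with hc
  have hc0 : 0 < c := by positivity
  have hB3 : c * (2 * B ^ 3) = 1 / 24 := by rw [hc]; field_simp; norm_num
  -- Of the first `k` steps, `a` decrease `f` and `d` shrink `h`. The last bound survives shrinking
  -- steps because `f` is monotone.
  have key : ∀ k : ℕ, ∃ a d : ℕ, a + d = k ∧ 4 ^ d * h k ^ 2 ≤ 2 ^ a * h 0 ^ 2 ∧
      c * √(f k) * a ≤ 1 := by
    intro k
    induction k with
    | zero => exact ⟨0, 0, rfl, by simp, by simp⟩
    | succ k ih =>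
      obtain ⟨a, d, had, h1, h2⟩ := ih
      have hsq := Real.sqrt_le_sqrt (hmono k)
      rcases halt k with h3 | h3
      · refine ⟨a, d + 1, by omega, ?_, ?_⟩
        · rw [pow_succ, mul_assoc]
          exact (mul_le_mul_of_nonneg_left h3 (by positivity)).trans h1
        · refine le_trans ?_ h2
          gcongr
      · refine ⟨a + 1, d, by omega, ?_, ?_⟩
        · calc (4 : ℝ) ^ d * h (k + 1) ^ 2 ≤ 4 ^ d * (2 * h k ^ 2) := by gcongr; exact hgrow k
            _ = 2 * (4 ^ d * h k ^ 2) := by ring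
            _ ≤ 2 * (2 ^ a * h 0 ^ 2) := by gcongr
            _ = _ := by ring
        · set p := √(f k) with hp
          set q := √(f (k + 1)) with hq
          have hp0 : 0 ≤ p := Real.sqrt_nonneg _
          have hq0 : 0 ≤ q := Real.sqrt_nonneg _
          have hp2 : p ^ 2 = f k := Real.sq_sqrt (hf k)
          have hq2 : q ^ 2 = f (k + 1) := Real.sq_sqrt (hf _)
          have hpB : p ≤ B * h k :=
            abs_le_of_sq_le_sq' (by rw [hp2, mul_pow]; exact hfh k) (mul_nonneg hB.le (hh k)) |>.2
          have hcube : p ^ 3 ≤ B ^ 3 * h k ^ 3 := by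
            rw [← mul_pow]; exact pow_le_pow_left₀ hp0 hpB 3
          have h4 : q ^ 2 + 2 * c * p ^ 3 ≤ p ^ 2 := by
            have := mul_le_mul_of_nonneg_left hcube (by positivity : 0 ≤ 2 * c)
            have h5 : 2 * c * (B ^ 3 * h k ^ 3) = h k ^ 3 / 24 := by
              linear_combination (h k ^ 3) * hB3
            linarith
          have ht1 : c * p ≤ 1 := by
            by_contra! h6
            have : 0 < p := by
              by_contra! h7
              have : p = 0 := le_antisymm h7 hp0
              rw [this] at h6; norm_num at h6
            nlinarith [pow_pos this 2, sq_nonneg q]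
          have h5 : q ≤ p * (1 - c * p) := by
            refine abs_le_of_sq_le_sq' ?_ (mul_nonneg hp0 (by linarith)) |>.2
            -- The square of `p * (1 - c * p)` is `p ^ 2 - 2 * c * p ^ 3 + (c * p ^ 2) ^ 2`.
            nlinarith [sq_nonneg (c * p ^ 2)]
          have h6 : c * q ≤ c * p - (c * p) ^ 2 := by
            have := mul_le_mul_of_nonneg_left h5 hc0.le
            linarith
          have ht0 : 0 ≤ c * p := by positivity
          generalize c * p = t at *
          generalize c * q = s at *
          push_cast
          have ha : (0 : ℝ) ≤ a := by positivity
          -- Uses `1 - (t - t ^ 2) * (a + 1) = (1 - t * a) * (1 - t) + t ^ 2`.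
          calc s * (a + 1) ≤ (t - t ^ 2) * (a + 1) := by gcongr
            _ ≤ 1 := by nlinarith [mul_nonneg (sub_nonneg.2 h2) (sub_nonneg.2 ht1), sq_nonneg t]
  refine ⟨4 / c ^ 2 + 16 * (B ^ 2 * h 0 ^ 2), by positivity, fun k => ?_⟩
  obtain ⟨a, d, had, h1, h2⟩ := key k
  have hX : 0 ≤ 16 * (B ^ 2 * h 0 ^ 2) := by positivity
  have hY : 0 ≤ 4 / c ^ 2 := by positivity
  rcases le_or_gt k (2 * a) with hk | hk
  · have hk' : (k : ℝ) ≤ 2 * a := by exact_mod_cast hk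
    have h3 : c * √(f k) * k ≤ 2 := by
      have := mul_le_mul_of_nonneg_left hk' (mul_nonneg hc0.le (Real.sqrt_nonneg (f k)))
      linarith
    have h4 : (c * √(f k) * k) ^ 2 ≤ 2 ^ 2 :=
      pow_le_pow_left₀ (by positivity) h3 2
    have h5 : f k * (k : ℝ) ^ 2 ≤ 4 / c ^ 2 := by
      rw [le_div_iff₀ (by positivity)]
      rw [mul_pow, mul_pow, Real.sq_sqrt (hf k)] at h4
      linarith
    linarith
  -- Here `a < d`, so the net exponent `N = 2 * d - a` is at least `k / 2`, and `2 ^ N` outweighs `k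
  -- ^ 2`.
  · obtain ⟨N, hN⟩ : ∃ N, 2 * d = a + N := ⟨2 * d - a, by omega⟩
    have hkN : k ≤ 2 * N := by omega
    have hkN' : (k : ℝ) ≤ 2 * N := by exact_mod_cast hkN
    have h3 : 2 ^ N * h k ^ 2 ≤ h 0 ^ 2 := by
      have h4 : (4 : ℝ) ^ d = 2 ^ a * 2 ^ N := by
        rw [← pow_add, ← hN, pow_mul]; norm_num
      rw [h4, mul_assoc] at h1
      exact le_of_mul_le_mul_left h1 (by positivity)
    have h4 : (k : ℝ) ^ 2 ≤ 16 * 2 ^ N := by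
      have := sq_le_four_mul_two_pow N
      nlinarith [pow_le_pow_left₀ (by positivity) hkN' 2]
    have h5 : f k * (k : ℝ) ^ 2 ≤ (B ^ 2 * h k ^ 2) * (16 * 2 ^ N) :=
      mul_le_mul (hfh k) h4 (by positivity) (by positivity)
    have h6 : B ^ 2 * (2 ^ N * h k ^ 2) ≤ B ^ 2 * h 0 ^ 2 := by gcongr
    linarith

end Rate

/-! ### One regularised Newton step, and the resulting rate. -/

section NewtonRate

variable {E : Type*} [NormedAddCommGroup E] [InnerProductSpace ℝ E]

lemma isInvertible_add_smul_id [FiniteDimensional ℝ E] {H : E →L[ℝ] E} (hH : ∀ d, 0 ≤ ⟪H d, d⟫) {μ : ℝ} (hμ : 0 < μ) :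
    (H + μ • ContinuousLinearMap.id ℝ E).IsInvertible := by
  have hinj : Function.Injective (H + μ • ContinuousLinearMap.id ℝ E : E →L[ℝ] E) := by
    rw [injective_iff_map_eq_zero]
    intro d hd
    have h1 : ⟪H d, d⟫ + μ * ‖d‖ ^ 2 = 0 := by
      rw [← real_inner_self_eq_norm_sq, ← real_inner_smul_left, ← inner_add_left]
      simpa using congrArg (fun x => ⟪x, d⟫) hd
    have h2 : ‖d‖ ^ 2 = 0 := by nlinarith [hH d, sq_nonneg ‖d‖]
    simpa using h2
  exact ⟨(LinearEquiv.ofInjectiveEndo _ hinj).toContinuousLinearEquiv, by ext x; rfl⟩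

variable [CompleteSpace E] {f : E → ℝ}

lemma lmParam_nonneg (z : E) : 0 ≤ lmParam f z := Real.sqrt_nonneg _

lemma two_mul_lmParam_sq (z : E) : 2 * lmParam f z ^ 2 = ‖gradient f z‖ := by
  rw [lmParam, Real.sq_sqrt (by positivity)]; ring

lemma lmParam_pos {z : E} (h : gradient f z ≠ 0) : 0 < lmParam f z :=
  Real.sqrt_pos.2 (by have := norm_pos_iff.2 h; positivity)

variable [FiniteDimensional ℝ E]

lemma lmOperator_isInvertible (hH : ∀ z d, 0 ≤ ⟪hessian f z d, d⟫) {z : E}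
    (h : gradient f z ≠ 0) : (lmOperator f z).IsInvertible :=
  isInvertible_add_smul_id (hH z) (lmParam_pos h)

/-- The defining equation of the step. -/
lemma hessian_lmStep (hH : ∀ z d, 0 ≤ ⟪hessian f z d, d⟫) (z : E) :
    hessian f z (lmStep f z - z) + lmParam f z • (lmStep f z - z) = -gradient f z := by
  by_cases h : gradient f z = 0
  -- Whatever `inverse` returns here, it is applied to `0`, so the step vanishes.
  · simp [lmStep, h]
  · obtain ⟨e, he⟩ := lmOperator_isInvertible hH h
    have h1 : lmOperator f z ((lmOperator f z).inverse (gradient f z)) = gradient f z := by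
      rw [← he, ContinuousLinearMap.inverse_equiv]; simp
    have h2 : lmStep f z - z = -(lmOperator f z).inverse (gradient f z) := by
      rw [lmStep]; abel
    rw [h2]
    rw [lmOperator] at h1 ⊢
    simpa [add_comm] using congrArg (fun x => -x) h1

/-- Pairing the step equation with `d` and dropping the Hessian term leaves `μ * ‖d‖ ^ 2 ≤ 2 * μ ^ 2
* ‖d‖`. -/
lemma norm_lmStep_sub_le (hH : ∀ z d, 0 ≤ ⟪hessian f z d, d⟫) (z : E) :
    ‖lmStep f z - z‖ ≤ 2 * lmParam f z := by
  set d := lmStep f z - z with hd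
  set μ := lmParam f z with hμ
  have hμ0 : 0 ≤ μ := lmParam_nonneg z
  have hg : 2 * μ ^ 2 = ‖gradient f z‖ := two_mul_lmParam_sq z
  by_cases h : gradient f z = 0
  · have : d = 0 := by simp [hd, lmStep, h]
    rw [this]; simpa using hμ0
  have hpos : 0 < μ := lmParam_pos h
  have h1 : ⟪hessian f z d, d⟫ + μ * ‖d‖ ^ 2 = ⟪-gradient f z, d⟫ := by
    rw [← hessian_lmStep hH z, inner_add_left, real_inner_smul_left, real_inner_self_eq_norm_sq]
  have h2 : ⟪-gradient f z, d⟫ ≤ 2 * μ ^ 2 * ‖d‖ := by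
    rw [hg, ← norm_neg]; exact real_inner_le_norm _ _
  rcases (norm_nonneg d).eq_or_lt with h3 | h3
  · rw [← h3]; linarith
  · have h4 : (μ * ‖d‖) * ‖d‖ ≤ (μ * ‖d‖) * (2 * μ) := by nlinarith [hH z d]
    exact le_of_mul_le_mul_left h4 (by positivity)

/-- By the step equation, the new gradient is the Taylor remainder minus `μ • d`; the remainder is
at most `‖d‖ ^ 2 / 2 ≤ μ * ‖d‖`. -/
lemma norm_gradient_lmStep_le (hH : ∀ z d, 0 ≤ ⟪hessian f z d, d⟫)
    (hgrad : ∀ z d, ‖gradient f (z + d) - gradient f z - hessian f z d‖ ≤ ‖d‖ ^ 2 / 2) (z : E) :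
    ‖gradient f (lmStep f z)‖ ≤ 2 * lmParam f z * ‖lmStep f z - z‖ := by
  have h1 := hgrad z (lmStep f z - z)
  have h2 := norm_lmStep_sub_le hH z
  have h3 := hessian_lmStep hH z
  rw [add_sub_cancel] at h1
  set d := lmStep f z - z with hd
  have h4 : gradient f (lmStep f z) =
      (gradient f (lmStep f z) - gradient f z - hessian f z d) - lmParam f z • d := by
    have : gradient f z = -(hessian f z d + lmParam f z • d) := by rw [h3, neg_neg]
    rw [this]; abel
  have h5 := norm_sub_le (gradient f (lmStep f z) - gradient f z - hessian f z d)
    (lmParam f z • d)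
  rw [← h4, norm_smul, Real.norm_of_nonneg (lmParam_nonneg z)] at h5
  nlinarith [norm_nonneg d]

/-- The quadratic model drops by at least `μ * ‖d‖ ^ 2`, and `‖d‖ ≤ 2 * μ` lets the cubic error
consume at most a third of that. -/
lemma lmStep_descent (hH : ∀ z d, 0 ≤ ⟪hessian f z d, d⟫)
    (hf : ∀ z d, f (z + d) ≤ f z + ⟪gradient f z, d⟫ + 1 / 2 * ⟪hessian f z d, d⟫ + ‖d‖ ^ 3 / 6)
    (z : E) : f (lmStep f z) + 2 / 3 * lmParam f z * ‖lmStep f z - z‖ ^ 2 ≤ f z := by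
  have h1 := hf z (lmStep f z - z)
  have h2 := norm_lmStep_sub_le hH z
  have h3 := hessian_lmStep hH z
  rw [add_sub_cancel] at h1
  set d := lmStep f z - z with hd
  have h4 : ⟪hessian f z d, d⟫ + lmParam f z * ‖d‖ ^ 2 = -⟪gradient f z, d⟫ := by
    rw [← inner_neg_left, ← h3, inner_add_left, real_inner_smul_left, real_inner_self_eq_norm_sq]
  nlinarith [hH z d, mul_nonneg (sub_nonneg.2 h2) (sq_nonneg ‖d‖)]

/-- The `O(1 / k²)` rate of the regularised Newton method for a convex function with minimal
value `0`, bounded sublevel sets and a `1`-Lipschitz Hessian. -/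
theorem exists_lmIterate_rate (hH : ∀ z d, 0 ≤ ⟪hessian f z d, d⟫)
    (hgrad : ∀ z d, ‖gradient f (z + d) - gradient f z - hessian f z d‖ ≤ ‖d‖ ^ 2 / 2)
    (hf : ∀ z d, f (z + d) ≤ f z + ⟪gradient f z, d⟫ + 1 / 2 * ⟪hessian f z d, d⟫ + ‖d‖ ^ 3 / 6)
    (hconv : ∀ z u, f z + ⟪gradient f z, u - z⟫ ≤ f u) (hnonneg : ∀ z, 0 ≤ f z)
    {z₀ u : E} {R : ℝ} (hu : f u = 0) (hR : ∀ z, f z ≤ f z₀ → ‖z‖ ≤ R) :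
    ∃ C : ℝ, 0 < C ∧ ∀ k : ℕ, f (lmIterate f z₀ k) * (k : ℝ) ^ 2 ≤ C := by
  have hR0 : 0 ≤ R := (norm_nonneg u).trans (hR u (hu.le.trans (hnonneg z₀)))
  have hdesc : ∀ z, f (lmStep f z) ≤ f z := fun z => by
    have := lmStep_descent hH hf z
    nlinarith [mul_nonneg (lmParam_nonneg (f := f) z) (sq_nonneg ‖lmStep f z - z‖)]
  have hlev : ∀ k, f (lmIterate f z₀ k) ≤ f z₀ := by
    intro k
    induction k with
    | zero => exact le_rfl
    | succ k ih => exact (hdesc _).trans ih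
  -- Convexity gives `f z ≤ ‖∇f z‖ * ‖z - u‖ ≤ 2 * μ ^ 2 * (2 * R)`; the extra `1` keeps `B`
  -- positive when `R = 0`.
  set B : ℝ := √(4 * R + 1) with hBdef
  have hB2 : B ^ 2 = 4 * R + 1 := Real.sq_sqrt (by linarith)
  refine exists_mul_sq_le_of_alternative (f := fun k => f (lmIterate f z₀ k))
    (h := fun k => lmParam f (lmIterate f z₀ k)) (B := B) (Real.sqrt_pos.2 (by linarith))
    (fun k => hnonneg _) (fun k => lmParam_nonneg _) (fun k => ?_) (fun k => hdesc _) ?_ ?_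
  · generalize hz : lmIterate f z₀ k = z
    have h1 := hconv z u
    have h2 := real_inner_le_norm (gradient f z) (z - u)
    rw [← neg_sub, inner_neg_right, hu] at h1
    have h3 : ‖z - u‖ ≤ 2 * R := by
      have h4 := hR z (hz ▸ hlev k)
      have h5 := hR u (hu.le.trans (hnonneg z₀))
      have := norm_sub_le z u
      linarith
    have h4 := two_mul_lmParam_sq (f := f) z
    rw [hB2]
    nlinarith [mul_le_mul_of_nonneg_left h3 (norm_nonneg (gradient f z)),
      sq_nonneg (lmParam f z)]
  · intro k
    change lmParam f (lmStep f _) ^ 2 ≤ _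
    generalize lmIterate f z₀ k = z
    have h1 := norm_gradient_lmStep_le hH hgrad z
    have h2 := norm_lmStep_sub_le hH z
    have h3 := two_mul_lmParam_sq (f := f) (lmStep f z)
    have h4 := lmParam_nonneg (f := f) z
    nlinarith [mul_nonneg h4 (sub_nonneg.2 h2)]
  · intro k
    change 4 * lmParam f (lmStep f _) ^ 2 ≤ _ ∨ f (lmStep f _) + _ ≤ _
    generalize lmIterate f z₀ k = z
    refine or_iff_not_imp_left.2 fun h => ?_
    -- A new gradient that is not small forces `μ ≤ 4 * r`, so the descent `2 / 3 * μ * r ^ 2` is at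
    -- least `μ ^ 3 / 24`.
    rw [not_le] at h
    have h1 := norm_gradient_lmStep_le hH hgrad z
    have h3 := two_mul_lmParam_sq (f := f) (lmStep f z)
    have h5 := lmStep_descent hH hf z
    have h4 := lmParam_nonneg (f := f) z
    set μ := lmParam f z
    set r := ‖lmStep f z - z‖
    rcases h4.eq_or_lt with h6 | h6
    · rw [← h6] at h5 ⊢; linarith
    · have h7 : μ * μ ≤ μ * (4 * r) := by nlinarith
      have h8 : μ ≤ 4 * r := le_of_mul_le_mul_left h7 h6
      have h9 : μ ^ 2 ≤ (4 * r) ^ 2 := pow_le_pow_left₀ h4 h8 2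
      have := mul_le_mul_of_nonneg_left h9 h4
      linarith

end NewtonRate

/-! ### The linear programs: duality, recession directions, accuracy. -/

section LinearProgram

variable {m n : ℕ} {A : Matrix (Fin m) (Fin n) ℝ} {b : Fin m → ℝ} {c : Fin n → ℝ}

/-- The triple `(x, y, s)` as a point of `PDSpace`. -/
def triple (x : Fin n → ℝ) (y : Fin m → ℝ) (s : Fin n → ℝ) : PDSpace m n :=
  WithLp.toLp 2 (Sum.elim x (Sum.elim y s))

@[simp] lemma xPart_triple (x : Fin n → ℝ) (y : Fin m → ℝ) (s : Fin n → ℝ) :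
    xPart (triple x y s) = x := rfl

@[simp] lemma yPart_triple (x : Fin n → ℝ) (y : Fin m → ℝ) (s : Fin n → ℝ) :
    yPart (triple x y s) = y := rfl

@[simp] lemma sPart_triple (x : Fin n → ℝ) (y : Fin m → ℝ) (s : Fin n → ℝ) :
    sPart (triple x y s) = s := rfl

lemma triple_inl (x : Fin n → ℝ) (y : Fin m → ℝ) (s : Fin n → ℝ) (j : Fin n) :
    triple x y s (Sum.inl j) = x j := rfl

lemma triple_inr_inr (x : Fin n → ℝ) (y : Fin m → ℝ) (s : Fin n → ℝ) (j : Fin n) :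
    triple x y s (Sum.inr (Sum.inr j)) = s j := rfl

@[simp] lemma xPart_add (z d : PDSpace m n) : xPart (z + d) = xPart z + xPart d := rfl

@[simp] lemma yPart_add (z d : PDSpace m n) : yPart (z + d) = yPart z + yPart d := rfl

@[simp] lemma sPart_add (z d : PDSpace m n) : sPart (z + d) = sPart z + sPart d := rfl

@[simp] lemma xPart_smul (t : ℝ) (z : PDSpace m n) : xPart (t • z) = t • xPart z := rfl

@[simp] lemma yPart_smul (t : ℝ) (z : PDSpace m n) : yPart (t • z) = t • yPart z := rfl

@[simp] lemma sPart_smul (t : ℝ) (z : PDSpace m n) : sPart (t • z) = t • sPart z := rfl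

/-- The linear part of the residuals of the optimality conditions. -/
noncomputable def residualMap (A : Matrix (Fin m) (Fin n) ℝ) (b : Fin m → ℝ) (c : Fin n → ℝ) :
    PDSpace m n →L[ℝ] EuclideanSpace ℝ (Unit ⊕ (Fin m ⊕ Fin n)) :=
  LinearMap.toContinuousLinearMap
    { toFun := fun z => WithLp.toLp 2 (Sum.elim (fun _ => c ⬝ᵥ xPart z - b ⬝ᵥ yPart z)
        (Sum.elim (A *ᵥ xPart z) (Aᵀ *ᵥ yPart z + sPart z)))
      map_add' := fun x y => by
        ext (i | i | i)
        · simp; ring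
        · simp [Matrix.mulVec_add]
        · simp [Matrix.mulVec_add]; ring
      map_smul' := fun r x => by
        ext (i | i | i)
        · simp; ring
        · simp [Matrix.mulVec_smul]
        · simp [Matrix.mulVec_smul]; ring }

lemma residualMap_apply (z : PDSpace m n) : residualMap A b c z =
    WithLp.toLp 2 (Sum.elim (fun _ => c ⬝ᵥ xPart z - b ⬝ᵥ yPart z)
      (Sum.elim (A *ᵥ xPart z) (Aᵀ *ᵥ yPart z + sPart z))) := rfl

/-- The constant part of the residuals of the optimality conditions. -/
noncomputable def residualTarget (b : Fin m → ℝ) (c : Fin n → ℝ) :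
    EuclideanSpace ℝ (Unit ⊕ (Fin m ⊕ Fin n)) :=
  WithLp.toLp 2 (Sum.elim 0 (Sum.elim b c))

/-- The coordinates of `x` and `s` are penalised, those of `y` are not. -/
def signWeight (m n : ℕ) : Fin n ⊕ (Fin m ⊕ Fin n) → ℝ := Sum.elim 1 (Sum.elim 0 1)

lemma signWeight_nonneg (i : Fin n ⊕ (Fin m ⊕ Fin n)) : 0 ≤ signWeight m n i := by
  rcases i with i | i | i <;> simp [signWeight]

lemma signWeight_le_one (i : Fin n ⊕ (Fin m ⊕ Fin n)) : signWeight m n i ≤ 1 := by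
  rcases i with i | i | i <;> simp [signWeight]

lemma merit_eq_penaltyModel :
    merit A b c = penaltyModel (residualMap A b c) (residualTarget b c) (signWeight m n) := by
  funext z
  rw [merit, penaltyModel, EuclideanSpace.real_norm_sq_eq, EuclideanSpace.real_norm_sq_eq,
    EuclideanSpace.real_norm_sq_eq]
  simp only [residualMap_apply, residualTarget, signWeight, Fintype.sum_sum_type, PiLp.sub_apply,
    Sum.elim_inl, Sum.elim_inr, dualityGap, primalResidual, dualResidual, Pi.sub_apply,
    Pi.one_apply, Pi.zero_apply, one_mul, zero_mul, Finset.sum_const_zero, Finset.univ_unique,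
    Finset.sum_singleton, sub_zero, ← Finset.sum_div, Finset.sum_add_distrib, xPart, sPart]
  ring

lemma inner_residual (z : PDSpace m n) (q : EuclideanSpace ℝ (Unit ⊕ (Fin m ⊕ Fin n))) :
    ⟪residualMap A b c z - residualTarget b c, q⟫ =
      dualityGap b c z * q (Sum.inl ()) +
        (A *ᵥ xPart z - b) ⬝ᵥ (fun i => q (Sum.inr (Sum.inl i))) +
        (Aᵀ *ᵥ yPart z + sPart z - c) ⬝ᵥ (fun i => q (Sum.inr (Sum.inr i))) := by
  simp [PiLp.inner_apply, Fintype.sum_sum_type, residualMap_apply, residualTarget, dotProduct,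
    dualityGap]
  simp only [mul_comm, add_assoc]

lemma dotProduct_nonneg {k : ℕ} {x y : Fin k → ℝ} (hx : ∀ j, 0 ≤ x j) (hy : ∀ j, 0 ≤ y j) :
    0 ≤ x ⬝ᵥ y :=
  Finset.sum_nonneg fun j _ => mul_nonneg (hx j) (hy j)

lemma transpose_mulVec_dotProduct (A : Matrix (Fin m) (Fin n) ℝ) (y : Fin m → ℝ)
    (x : Fin n → ℝ) : (Aᵀ *ᵥ y) ⬝ᵥ x = y ⬝ᵥ (A *ᵥ x) := by
  rw [Matrix.mulVec_transpose, Matrix.dotProduct_mulVec]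

/-- Weak duality. -/
lemma le_of_feasible {x : Fin n → ℝ} {y : Fin m → ℝ} {s : Fin n → ℝ}
    (hx : PrimalFeasible A b x) (hy : DualFeasible A c y s) : b ⬝ᵥ y ≤ c ⬝ᵥ x := by
  rw [← hx.1, ← hy.1, add_dotProduct, transpose_mulVec_dotProduct, dotProduct_comm]
  linarith [dotProduct_nonneg hy.2 hx.2]

/-- A theorem of the alternative: multipliers of a homogenised feasible pair of programs. -/
lemma nonneg_of_homogenised_feasible {x : Fin n → ℝ} {y : Fin m → ℝ} {s : Fin n → ℝ}
    (hx : PrimalFeasible A b x) (hy : DualFeasible A c y s) {τ : ℝ} {u : Fin m → ℝ}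
    {v p : Fin n → ℝ} (hp : ∀ j, 0 ≤ p j) (hv : ∀ j, 0 ≤ v j)
    (hup : τ • c + Aᵀ *ᵥ u = p) (hvb : A *ᵥ v = τ • b) : 0 ≤ u ⬝ᵥ b + v ⬝ᵥ c := by
  -- For `τ ≤ 0` the quantity equals `p ⬝ᵥ x + s ⬝ᵥ v + τ * (b ⬝ᵥ y - c ⬝ᵥ x)`, settled by weak
  -- duality; for `τ > 0`, `τ` times it is `p ⬝ᵥ v`.
  rcases le_or_gt τ 0 with hτ | hτ
  · have h1 : u ⬝ᵥ b = p ⬝ᵥ x - τ * (c ⬝ᵥ x) := by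
      rw [← hup, add_dotProduct, smul_dotProduct, transpose_mulVec_dotProduct, hx.1, smul_eq_mul]
      ring
    have h2 : v ⬝ᵥ c = τ * (b ⬝ᵥ y) + s ⬝ᵥ v := by
      rw [dotProduct_comm, ← hy.1, add_dotProduct, transpose_mulVec_dotProduct, hvb,
        dotProduct_smul, dotProduct_comm, smul_eq_mul]
    have h3 := le_of_feasible hx hy
    nlinarith [dotProduct_nonneg hp hx.2, dotProduct_nonneg hy.2 hv]
  · have h1 : p ⬝ᵥ v = τ * (u ⬝ᵥ b + v ⬝ᵥ c) := by
      rw [← hup, add_dotProduct, smul_dotProduct, transpose_mulVec_dotProduct, hvb,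
        dotProduct_smul, smul_eq_mul, smul_eq_mul, dotProduct_comm c v]
      ring
    have h2 := dotProduct_nonneg hp hv
    rw [h1] at h2
    exact nonneg_of_mul_nonneg_right h2 hτ

/-- If both programs are feasible, then a stationary point of the merit function is a zero. -/
lemma penaltyModel_eq_zero_of_feasible {x : Fin n → ℝ} {y : Fin m → ℝ} {s : Fin n → ℝ}
    (hx : PrimalFeasible A b x) (hy : DualFeasible A c y s) {z : PDSpace m n}
    (hz : penaltyGradient (residualMap A b c) (residualTarget b c) (signWeight m n) z = 0) :
    penaltyModel (residualMap A b c) (residualTarget b c) (signWeight m n) z = 0 := by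
  refine penaltyModel_eq_zero _ _ signWeight_nonneg hz ?_
  have key : ∀ dx dy ds, dualityGap b c z * (c ⬝ᵥ dx - b ⬝ᵥ dy)
      + (A *ᵥ xPart z - b) ⬝ᵥ (A *ᵥ dx)
      + (Aᵀ *ᵥ yPart z + sPart z - c) ⬝ᵥ (Aᵀ *ᵥ dy + ds)
      = (fun j => max (-xPart z j) 0 ^ 2 / 2) ⬝ᵥ dx
        + (fun j => max (-sPart z j) 0 ^ 2 / 2) ⬝ᵥ ds := by
    intro dx dy ds
    have h := inner_penaltyGradient (residualMap A b c) (residualTarget b c) (w := signWeight m n)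
      z (triple dx dy ds)
    rw [hz, inner_zero_left, inner_residual] at h
    simp only [residualMap_apply, xPart_triple, yPart_triple, sPart_triple, Sum.elim_inl,
      Sum.elim_inr, Fintype.sum_sum_type, signWeight, Pi.one_apply, Pi.zero_apply, one_mul,
      zero_mul, Finset.sum_const_zero, zero_add, triple_inl, triple_inr_inr] at h
    simp only [dotProduct, xPart, sPart] at h ⊢
    linarith
  rw [inner_residual]
  simp only [residualTarget, Sum.elim_inl, Sum.elim_inr, Pi.zero_apply, mul_zero, zero_add]
  -- The residuals serve as multipliers: `τ` is the gap, `u` the primal and `v` the dual residual.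
  -- Stationarity in `s`, `x` and `y` supplies the sign of `v` and the two equations.
  refine nonneg_of_homogenised_feasible hx hy (τ := dualityGap b c z)
    (p := fun j => max (-xPart z j) 0 ^ 2 / 2) (fun j => by positivity) (fun j => ?_) ?_ ?_
  · have h : Aᵀ *ᵥ yPart z + sPart z - c = fun j => max (-sPart z j) 0 ^ 2 / 2 := by
      refine dotProduct_eq _ _ fun d => ?_
      simpa using key 0 0 d
    rw [h]; positivity
  · refine dotProduct_eq _ _ fun d => ?_
    rw [add_dotProduct, smul_dotProduct, transpose_mulVec_dotProduct]
    simpa using key d 0 0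
  · refine dotProduct_eq _ _ fun d => ?_
    have h := key 0 d 0
    rw [add_zero, dotProduct_comm _ (Aᵀ *ᵥ d), transpose_mulVec_dotProduct, dotProduct_comm d] at h
    rw [smul_dotProduct, smul_eq_mul]
    simp at h
    linarith

/-- If the optimal set is nonempty and bounded, then the merit function has no nonzero recession
direction. -/
lemma eq_zero_of_recession (hne : (optimalSet A b c).Nonempty)
    (hbd : Bornology.IsBounded (optimalSet A b c)) {d : PDSpace m n}
    (hd : residualMap A b c d = 0) (hd' : ∀ i, signWeight m n i * max (-d i) 0 = 0) : d = 0 := by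
  obtain ⟨z, hzp, hzd⟩ := hne
  have h0 : c ⬝ᵥ xPart d - b ⬝ᵥ yPart d = 0 := by
    simpa [residualMap_apply] using congrArg (fun q => q (Sum.inl ())) hd
  have h1 : A *ᵥ xPart d = 0 := funext fun i => by
    simpa [residualMap_apply] using congrArg (fun q => q (Sum.inr (Sum.inl i))) hd
  have h2 : Aᵀ *ᵥ yPart d + sPart d = 0 := funext fun i => by
    simpa [residualMap_apply] using congrArg (fun q => q (Sum.inr (Sum.inr i))) hd
  have h3 : ∀ j, 0 ≤ xPart d j := fun j => by simpa [signWeight, xPart] using hd' (Sum.inl j)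
  have h4 : ∀ j, 0 ≤ sPart d j := fun j => by simpa [signWeight, sPart] using hd' (Sum.inr (Sum.inr j))
  have hfp : ∀ t : ℝ, 0 ≤ t → PrimalFeasible A b (xPart z + t • xPart d) := fun t ht =>
    ⟨by rw [Matrix.mulVec_add, Matrix.mulVec_smul, h1, smul_zero, add_zero, hzp.1.1], fun j =>
      add_nonneg (hzp.1.2 j) (mul_nonneg ht (h3 j))⟩
  have hfd : ∀ t : ℝ, 0 ≤ t →
      DualFeasible A c (yPart z + t • yPart d) (sPart z + t • sPart d) := fun t ht =>
    ⟨by rw [Matrix.mulVec_add, Matrix.mulVec_smul, add_add_add_comm, ← smul_add, h2, smul_zero,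
      add_zero, hzd.1.1], fun j => add_nonneg (hzd.1.2 j) (mul_nonneg ht (h4 j))⟩
  -- Optimality gives `0 ≤ c ⬝ᵥ xPart d` and `b ⬝ᵥ yPart d ≤ 0`. By `h0` the two are equal, so both
  -- vanish and the whole ray is optimal.
  have h5 := hzp.2 _ (hfp 1 zero_le_one)
  have h6 := hzd.2 _ _ (hfd 1 zero_le_one)
  rw [one_smul, dotProduct_add] at h5 h6
  have h7 : c ⬝ᵥ xPart d = 0 := by linarith
  have h8 : b ⬝ᵥ yPart d = 0 := by linarith
  have hopt : ∀ t : ℝ, 0 ≤ t → z + t • d ∈ optimalSet A b c := by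
    refine fun t ht => ⟨⟨hfp t ht, fun x' hx' => ?_⟩, ⟨hfd t ht, fun y' s' hs' => ?_⟩⟩
    · simpa [dotProduct_add, h7] using hzp.2 x' hx'
    · simpa [dotProduct_add, h8] using hzd.2 y' s' hs'
  obtain ⟨R, hR⟩ := hbd.exists_norm_le
  by_contra hne
  have hpos := norm_pos_iff.2 hne
  have hR0 : 0 ≤ R := (norm_nonneg z).trans (hR z ⟨hzp, hzd⟩)
  have ht : 0 ≤ (2 * R + 1) / ‖d‖ := by positivity
  have h9 := hR _ (hopt _ ht)
  have h10 := norm_sub_le (z + ((2 * R + 1) / ‖d‖) • d) z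
  rw [add_sub_cancel_left, norm_smul, Real.norm_of_nonneg ht, div_mul_cancel₀ _ hpos.ne'] at h10
  linarith [hR z ⟨hzp, hzd⟩]

/-- The merit function attains the value `0`: the programs have optimal solutions without gap. -/
lemma exists_merit_eq_zero (hne : (optimalSet A b c).Nonempty)
    (hlev : ∀ a, ∃ R, ∀ z, merit A b c z ≤ a → ‖z‖ ≤ R) : ∃ u, merit A b c u = 0 := by
  obtain ⟨R, hR⟩ := hlev (merit A b c 0)
  have hcont : Continuous (merit A b c) := by
    rw [merit_eq_penaltyModel]; exact continuous_penaltyModel _ _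
  obtain ⟨u, hu, hmin⟩ := (isCompact_closedBall (0 : PDSpace m n) R).exists_isMinOn
    ⟨0, by simpa using hR 0 le_rfl⟩ hcont.continuousOn
  have hglob : ∀ z, merit A b c u ≤ merit A b c z := by
    intro z
    by_cases hz : merit A b c z ≤ merit A b c 0
    · exact hmin (by simpa using hR z hz)
    · exact (hmin (by simpa using hR 0 le_rfl)).trans (not_le.1 hz).le
  obtain ⟨z, hzp, hzd⟩ := hne
  refine ⟨u, ?_⟩
  have hloc : IsLocalMin (merit A b c) u := Filter.Eventually.of_forall hglob
  have hfd := hloc.fderiv_eq_zero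
  have hg : gradient (merit A b c) u = 0 := by rw [gradient, hfd, map_zero]
  rw [merit_eq_penaltyModel] at hg ⊢
  rw [gradient_penaltyModel _ _ signWeight_nonneg signWeight_le_one] at hg
  exact penaltyModel_eq_zero_of_feasible hzp.1 hzd.1 hg

/-- The sign penalty dictates the threshold `ε ^ 3 / 6`; for the quadratic terms `ε ^ 3 ≤ ε ^ 2`
suffices, which is where `ε ≤ 1` enters. -/
lemma bounds_of_merit_le {z : PDSpace m n} {ε : ℝ} (hε : 0 < ε) (hε1 : ε ≤ 1)
    (h : merit A b c z ≤ ε ^ 3 / 6) :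
    |dualityGap b c z| ≤ ε ∧ ‖primalResidual A b z‖ ≤ ε ∧ ‖dualResidual A c z‖ ≤ ε ∧
      (∀ j, -ε ≤ xPart z j) ∧ (∀ j, -ε ≤ sPart z j) := by
  have hterm : ∀ j, 0 ≤ max (-(xPart z j)) 0 ^ 3 + max (-(sPart z j)) 0 ^ 3 := fun j => by
    positivity
  have hsum := Finset.sum_nonneg fun j (_ : j ∈ Finset.univ) => hterm j
  rw [merit] at h
  have h0 : ε ^ 3 ≤ ε ^ 2 := pow_le_pow_of_le_one hε.le hε1 (by norm_num)
  have hcube : ∀ j, max (-(xPart z j)) 0 ^ 3 + max (-(sPart z j)) 0 ^ 3 ≤ ε ^ 3 := fun j => by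
    have := Finset.single_le_sum (fun j _ => hterm j) (Finset.mem_univ j)
    nlinarith [sq_nonneg (dualityGap b c z), sq_nonneg ‖primalResidual A b z‖,
      sq_nonneg ‖dualResidual A c z‖]
  have hroot : ∀ t : ℝ, max (-t) 0 ^ 3 ≤ ε ^ 3 → -ε ≤ t := fun t ht => by
    have := le_of_pow_le_pow_left₀ (by norm_num) hε.le ht
    linarith [le_max_left (-t) 0]
  refine ⟨abs_le_of_sq_le_sq ?_ hε.le, abs_le_of_sq_le_sq' ?_ hε.le |>.2,
    abs_le_of_sq_le_sq' ?_ hε.le |>.2, fun j => hroot _ ?_, fun j => hroot _ ?_⟩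
  · nlinarith [sq_nonneg ‖primalResidual A b z‖, sq_nonneg ‖dualResidual A c z‖]
  · nlinarith [sq_nonneg (dualityGap b c z), sq_nonneg ‖dualResidual A c z‖]
  · nlinarith [sq_nonneg (dualityGap b c z), sq_nonneg ‖primalResidual A b z‖]
  · have : 0 ≤ max (-(sPart z j)) 0 ^ 3 := by positivity
    linarith [hcube j]
  · have : 0 ≤ max (-(xPart z j)) 0 ^ 3 := by positivity
    linarith [hcube j]

end LinearProgram

end LPMerit

theorem mainTheorem1 (m n : ℕ) (A : Matrix (Fin m) (Fin n) ℝ) (b : Fin m → ℝ) (c : Fin n → ℝ)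
    (hne : (LPMerit.optimalSet A b c).Nonempty)
    (hbd : Bornology.IsBounded (LPMerit.optimalSet A b c))
    (z₀ : LPMerit.PDSpace m n) :
    (∀ k : ℕ,
      gradient (LPMerit.merit A b c) (LPMerit.lmIterate (LPMerit.merit A b c) z₀ k) ≠ 0 →
      (LPMerit.lmOperator (LPMerit.merit A b c)
        (LPMerit.lmIterate (LPMerit.merit A b c) z₀ k)).IsInvertible) ∧
    ∃ C : ℝ, 0 < C ∧ ∀ ε : ℝ, 0 < ε → ε ≤ 1 →
      ∀ k : ℕ, C * ε ^ (-(3 / 2) : ℝ) ≤ (k : ℝ) →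
        |LPMerit.dualityGap b c (LPMerit.lmIterate (LPMerit.merit A b c) z₀ k)| ≤ ε ∧
        ‖LPMerit.primalResidual A b (LPMerit.lmIterate (LPMerit.merit A b c) z₀ k)‖ ≤ ε ∧
        ‖LPMerit.dualResidual A c (LPMerit.lmIterate (LPMerit.merit A b c) z₀ k)‖ ≤ ε ∧
        (∀ j, -ε ≤ LPMerit.xPart (LPMerit.lmIterate (LPMerit.merit A b c) z₀ k) j) ∧
        (∀ j, -ε ≤ LPMerit.sPart (LPMerit.lmIterate (LPMerit.merit A b c) z₀ k) j) := by
  open LPMerit RealInnerProductSpace in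
  have hw := @signWeight_nonneg m n
  have hw1 := @signWeight_le_one m n
  have hmerit := @merit_eq_penaltyModel m n A b c
  have hgr := gradient_penaltyModel (residualMap A b c) (residualTarget b c) hw hw1
  have hhs := hessian_penaltyModel (residualMap A b c) (residualTarget b c) hw hw1
  rw [← hmerit] at hgr hhs
  have hH : ∀ z d, 0 ≤ ⟪hessian (merit A b c) z d, d⟫ := fun z d => by
    rw [hhs]; exact inner_penaltyHessian_nonneg _ hw z d
  have hlev : ∀ a, ∃ R, ∀ z, merit A b c z ≤ a → ‖z‖ ≤ R := by
    rw [hmerit]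
    exact exists_norm_le_of_penaltyModel_le _ _ hw hw1 fun d => eq_zero_of_recession hne hbd
  refine ⟨fun k hk => lmOperator_isInvertible hH hk, ?_⟩
  obtain ⟨u, hu⟩ := exists_merit_eq_zero hne hlev
  obtain ⟨R, hR⟩ := hlev (merit A b c z₀)
  obtain ⟨C, hC, hrate⟩ := exists_lmIterate_rate (f := merit A b c) (z₀ := z₀) hH
    (fun z d => by
      rw [hhs, hgr]; exact norm_penaltyGradient_remainder_le _ _ hw hw1 z d)
    (fun z d => by
      rw [hhs, hgr, hmerit]
      have := (abs_le.1 (abs_penaltyModel_remainder_le (residualMap A b c) (residualTarget b c)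
        hw hw1 z d)).2
      linarith)
    (fun z u => by rw [hgr, hmerit]; exact penaltyModel_tangent_le _ _ hw z u)
    (fun z => by rw [hmerit]; exact penaltyModel_nonneg _ _ hw z) hu hR
  have hs : 0 < √(6 * C) := Real.sqrt_pos.2 (by positivity)
  -- Squaring `√(6 * C) * ε ^ (-3 / 2) ≤ k` gives `C / k ^ 2 ≤ ε ^ 3 / 6`.
  refine ⟨√(6 * C), hs, fun ε hε hε1 k hk => bounds_of_merit_le hε hε1 ?_⟩
  have hk2 : (√(6 * C) * ε ^ (-(3 / 2) : ℝ)) ^ 2 ≤ (k : ℝ) ^ 2 :=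
    pow_le_pow_left₀ (by positivity) hk 2
  have hpow : (ε ^ (-(3 / 2) : ℝ)) ^ 2 = (ε ^ 3)⁻¹ := by
    rw [← Real.rpow_natCast, ← Real.rpow_mul hε.le, ← Real.rpow_natCast, ← Real.rpow_neg hε.le]
    norm_num
  rw [mul_pow, Real.sq_sqrt (by positivity), hpow, ← div_eq_mul_inv,
    div_le_iff₀ (by positivity)] at hk2
  have h1 := hrate k
  have hkpos : 0 < (k : ℝ) ^ 2 := by
    by_contra! h
    nlinarith [pow_pos hε 3]
  generalize merit A b c _ = y at *
  refine le_of_mul_le_mul_right ?_ hkpos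
  linarith
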